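/- Let $n > k \ge r \ge 1$ be integers. An $(n,k,r)$-LRC is a $k$-dimensional linear code $C\subseteq\mathbb F^n$ over some finite field $\mathbb F$ (of arbitrary order) such that every coordinate $i$ has a set $S\not\ni i$ of at most $r$ other coordinates and coefficients $a_j\in\mathbb F$ with $c_i=\sum_{j\in S}a_jc_j$ for all $c\in C$. Let $\mathscr D(n,k,r)$ be the largest minimum Hamming distance of an $(n,k,r)$-LRC (it is undefined, and equal to no number, if there is no $(n,k,r)$-LRC). Put $$k_1=\left\lceil \tfrac{k}{r}\right\rceil,\quad k_2=k_1r-k,\quad n_1=\left\lceil \tfrac{n}{r+1}\right\rceil,\quad n_2=n_1(r+1)-n,\quad d^*=n-k-\left\lceil \tfrac{k}{r}\right\rceil+2 .$$ Let $ex(m,\{C_3,\dots,C_\ell\})$ denote the maximum number of edges of a simple graph on $m$ vertices that contains none of the cycles $C_3,C_4,\dots,C_\ell$ as a subgraph, i.e. that has no cycle of length at most $\ell$. **Theorem.** Suppose $k_1\le n_1$ (which holds whenever an $(n,k,r)$-LRC exists), $k_1\ge 3$ and $k_2=k_1-1$. Then $$\mathscr D(n,k,r)=d^*\quad\text{if and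 only if}\quad n_2\le ex(n_1,\{C_3,C_4,\dots,C_{k_1}\}).$$ -/

import Mathlib

/-- `k₁ = ⌈k / r⌉`. -/
def lrcK1 (k r : ℕ) : ℕ := k ⌈/⌉ r

/-- `k₂ = k₁ r - k` (for `r ≥ 1` the natural-number subtraction does not truncate). -/
def lrcK2 (k r : ℕ) : ℕ := lrcK1 k r * r - k

/-- `n₁ = ⌈n / (r + 1)⌉`. -/
def lrcN1 (n r : ℕ) : ℕ := n ⌈/⌉ (r + 1)

/-- `n₂ = n₁ (r + 1) - n` (the natural-number subtraction does not truncate). -/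
def lrcN2 (n r : ℕ) : ℕ := lrcN1 n r * (r + 1) - n

/-- `d* = n - k - ⌈k / r⌉ + 2`, as an integer. -/
def lrcDStar (n k r : ℕ) : ℤ := (n : ℤ) - k - lrcK1 k r + 2

/-- `C` is an `(n, k, r)`-locally recoverable code over `F`: a `k`-dimensional linear code of
length `n` in which every coordinate is a fixed linear combination of at most `r` other ones. -/
def IsLRC {F : Type} [Field F] {n : ℕ} (k r : ℕ) (C : Submodule F (Fin n → F)) : Prop :=
  Module.finrank F C = k ∧
    ∀ i : Fin n, ∃ (S : Finset (Fin n)) (a : Fin n → F),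
      i ∉ S ∧ S.card ≤ r ∧ ∀ c ∈ C, c i = ∑ j ∈ S, a j * c j

open Classical in
/-- The minimum Hamming distance between two distinct codewords of `C` is `d`. -/
def HasMinDistance {F : Type} [Field F] {n : ℕ} (C : Submodule F (Fin n → F)) (d : ℕ) : Prop :=
  IsLeast {e : ℕ | ∃ x ∈ C, ∃ y ∈ C, x ≠ y ∧ hammingDist x y = e} d

/-- The set of minimum distances of all `(n, k, r)`-LRCs, over all finite fields. -/
def lrcMinDistances (n k r : ℕ) : Set ℕ :=
  {d | ∃ (F : Type) (_ : Field F) (_ : Finite F) (C : Submodule F (Fin n → F)),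
    IsLRC k r C ∧ HasMinDistance C d}

/-- `𝒟(n, k, r) = d`: the largest minimum distance of an `(n, k, r)`-LRC is `d`. In particular
some `(n, k, r)`-LRC exists; there is no default value when there is none. -/
def LargestMinDistanceEq (n k r : ℕ) (d : ℤ) : Prop :=
  IsGreatest ((fun m : ℕ => (m : ℤ)) '' lrcMinDistances n k r) d

/-- `ex(n, 𝓕)`: the maximum number of edges of a simple graph on `n` vertices that contains no
member of `𝓕` as a (not necessarily induced) subgraph. -/
noncomputable def exFamily (n : ℕ) (𝓕 : Set (Σ m : ℕ, SimpleGraph (Fin m))) : ℕ :=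
  sSup {e | ∃ G : SimpleGraph (Fin n), (∀ H ∈ 𝓕, H.2.Free G) ∧ G.edgeSet.ncard = e}

/-- The family `{C₃, C₄, …, C_k}` of cycles. -/
def cycleFamily (k : ℕ) : Set (Σ m : ℕ, SimpleGraph (Fin m)) :=
  {H | ∃ l : ℕ, 3 ≤ l ∧ l ≤ k ∧ H = ⟨l, SimpleGraph.cycleGraph l⟩}

/-! Write `K = k₁`; the hypothesis on `k₂` says `k + K = K * r + 1`.

Necessity. Greedily choose `n₁` recovery sets of size `r + 1`, each recovering a coordinate outside
the earlier ones. If `t` of them cover fewer than `k + t` coordinates, then `k - 1` free zeros force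
`t` more, so `d ≤ n - k + 1 - t`. With `t = K - 1` this is always the case and gives `d ≤ d*`. With
`t = K` it would give `d < d*`, so in a code attaining `d*` any `K` sets cover more than `K * (r +
1) - K` coordinates. Record each repeated covering of a coordinate as an edge between two sets: no
`K` vertices of this multigraph span `K` edges, and it has at least `n₂` edges.
`card_edgesWithin_le_exFamily` bounds such a multigraph by the extremal number for simple graphs of
girth above `K`.

Sufficiency. Take `n₂` edges of an extremal graph. Its vertices become parity checks (sum over a
group of `r + 1` coordinates is zero), an edge is a coordinate shared by two groups, and private
coordinates fill the groups up. A generic `k`-dimensional subspace of the resulting code has no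
nonzero word with `K * r` zeros, hence distance at least `n - K * r + 1 = d*`. Genericity reduces
this to a rank bound for each set of `K * r` coordinates, which `IsSparseIncidence.finrank_lt`
supplies from the girth. -/

/-! ### Extremal numbers for graphs without short cycles -/

/-- `G` has no cycle of length at most `k`. -/
def GirthExceeds {V : Type*} (k : ℕ) (G : SimpleGraph V) : Prop :=
  ∀ l, 3 ≤ l → l ≤ k → (SimpleGraph.cycleGraph l).Free G

theorem GirthExceeds.of_isContained {V W : Type*} {k : ℕ} {G : SimpleGraph V} {H : SimpleGraph W}
    (hG : GirthExceeds k G) (h : H.IsContained G) : GirthExceeds k H :=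
  fun l h3 hl hc => hG l h3 hl (hc.trans h)

theorem SimpleGraph.IsAcyclic.girthExceeds {V : Type*} {G : SimpleGraph V} (h : G.IsAcyclic)
    (k : ℕ) : GirthExceeds k G :=
  fun l h3 _ => SimpleGraph.isAcyclic_iff_free_cycleGraph.mp h l h3

theorem forall_mem_cycleFamily_iff {V : Type*} {k : ℕ} {G : SimpleGraph V} :
    (∀ H ∈ cycleFamily k, H.2.Free G) ↔ GirthExceeds k G := by
  constructor
  · intro h l h3 hl
    exact h ⟨l, SimpleGraph.cycleGraph l⟩ ⟨l, h3, hl, rfl⟩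
  · rintro h _ ⟨l, h3, hl, rfl⟩
    exact h l h3 hl

/-- Boundedness is needed because `sSup` of an unbounded set of naturals is `0`. -/
theorem finite_edgeCounts (n : ℕ) (P : SimpleGraph (Fin n) → Prop) :
    {e | ∃ G : SimpleGraph (Fin n), P G ∧ G.edgeSet.ncard = e}.Finite := by
  refine (Set.finite_range fun G : SimpleGraph (Fin n) => G.edgeSet.ncard).subset ?_
  rintro _ ⟨G, -, rfl⟩
  exact ⟨G, rfl⟩

theorem exists_extremal_graph (n k : ℕ) :
    ∃ G : SimpleGraph (Fin n), GirthExceeds k G ∧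
      G.edgeSet.ncard = exFamily n (cycleFamily k) := by
  have hne : {e | ∃ G : SimpleGraph (Fin n),
      (∀ H ∈ cycleFamily k, H.2.Free G) ∧ G.edgeSet.ncard = e}.Nonempty :=
    ⟨_, ⊥, forall_mem_cycleFamily_iff.mpr (SimpleGraph.isAcyclic_bot.girthExceeds k), rfl⟩
  obtain ⟨G, hG, h⟩ := Nat.sSup_mem hne (finite_edgeCounts n _).bddAbove
  exact ⟨G, forall_mem_cycleFamily_iff.mp hG, h⟩

theorem GirthExceeds.ncard_edgeSet_le {V : Type*} [Fintype V] {k n : ℕ} {G : SimpleGraph V}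
    (hG : GirthExceeds k G) (hn : Fintype.card V = n) :
    G.edgeSet.ncard ≤ exFamily n (cycleFamily k) := by
  obtain ⟨e⟩ : Nonempty (V ≃ Fin n) := ⟨Fintype.equivFinOfCardEq hn⟩
  let φ : G ≃g G.map e.toEmbedding := SimpleGraph.Iso.map e G
  have hcard : G.edgeSet.ncard = (G.map e.toEmbedding).edgeSet.ncard :=
    Nat.card_congr φ.mapEdgeSet
  rw [hcard]
  refine le_csSup (finite_edgeCounts n _).bddAbove ⟨_, ?_, rfl⟩
  exact forall_mem_cycleFamily_iff.mpr (hG.of_isContained φ.symm.isContained)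

theorem SimpleGraph.IsAcyclic.ncard_edgeSet_lt {V : Type*} [Fintype V] [Nonempty V]
    {G : SimpleGraph V} (h : G.IsAcyclic) : G.edgeSet.ncard < Fintype.card V := by
  classical
  obtain ⟨T, hle, -, hT⟩ :=
    (SimpleGraph.connected_top (V := V)).exists_isTree_le_of_le_of_isAcyclic le_top h
  have h1 := (SimpleGraph.isTree_iff_connected_and_card.mp hT).2
  have h2 : G.edgeSet.ncard ≤ T.edgeSet.ncard :=
    Set.ncard_le_ncard (SimpleGraph.edgeSet_mono hle) (Set.toFinite _)
  rw [Nat.card_eq_fintype_card (α := V), Nat.card_coe_set_eq] at h1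
  omega

/-- A spanning star has no cycle at all. -/
theorem card_le_exFamily_add_one (n k : ℕ) : n ≤ exFamily n (cycleFamily k) + 1 := by
  rcases n with _ | n
  · omega
  have h1 := SimpleGraph.isTree_starGraph (0 : Fin (n + 1))
  have h2 := (h1.isAcyclic.girthExceeds k).ncard_edgeSet_le (Fintype.card_fin (n + 1))
  have h3 := (SimpleGraph.isTree_iff_connected_and_card.mp h1).2
  rw [Nat.card_eq_fintype_card (α := Fin (n + 1)), Nat.card_coe_set_eq, Fintype.card_fin] at h3
  omega

theorem card_le_ncard_edgeSet_cycleGraph {n : ℕ} (hn : 3 ≤ n) :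
    n ≤ (SimpleGraph.cycleGraph n).edgeSet.ncard := by
  classical
  obtain ⟨m, rfl⟩ : ∃ m, n = m + 3 := ⟨n - 3, by omega⟩
  have h := (SimpleGraph.cycleGraph (m + 3)).sum_degrees_eq_twice_card_edges
  simp only [SimpleGraph.cycleGraph_degree_three_le, Finset.sum_const, Finset.card_univ,
    Fintype.card_fin, smul_eq_mul] at h
  have h2 : (SimpleGraph.cycleGraph (m + 3)).edgeSet.ncard
      = (SimpleGraph.cycleGraph (m + 3)).edgeFinset.card := by
    rw [← SimpleGraph.coe_edgeFinset, Set.ncard_coe_finset]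
  omega

theorem Fin.add_one_ne_sub_one {l : ℕ} (i : Fin (l + 3)) : i + 1 ≠ i - 1 := by
  intro h
  have h' : (1 : Fin (l + 3)) + 1 = 0 := by
    have h2 : i + 1 - (i - 1) = 0 := by rw [h]; simp
    rw [← h2]; abel
  exact absurd (congrArg Fin.val h') (by simp [Fin.val_add, Nat.mod_eq_of_lt])

theorem girthExceeds_cycleGraph {n k : ℕ} (hkn : k < n) :
    GirthExceeds k (SimpleGraph.cycleGraph n) := by
  intro l h3 hl ⟨f⟩
  have hn : 3 ≤ n := by omega
  obtain ⟨m, rfl⟩ : ∃ m, n = m + 3 := ⟨n - 3, by omega⟩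
  obtain ⟨l, rfl⟩ : ∃ m, l = m + 3 := ⟨l - 3, by omega⟩
  -- The image of a cycle is closed under adjacency, hence everything.
  have hstep : ∀ v, v ∈ Set.range f → v + 1 ∈ Set.range f := by
    rintro _ ⟨i, rfl⟩
    have h1 : (SimpleGraph.cycleGraph (m + 3)).Adj (f i) (f (i + 1)) :=
      f.toHom.map_adj (by simp [SimpleGraph.cycleGraph_adj])
    have h2 : (SimpleGraph.cycleGraph (m + 3)).Adj (f i) (f (i - 1)) :=
      f.toHom.map_adj (by simp [SimpleGraph.cycleGraph_adj])
    have h12 : f (i + 1) ≠ f (i - 1) := f.injective.ne (Fin.add_one_ne_sub_one i)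
    rw [SimpleGraph.cycleGraph_adj] at h1 h2
    rcases h1 with h1 | h1
    · rcases h2 with h2 | h2
      · exact absurd (sub_right_injective (h1.trans h2.symm)) h12
      · exact ⟨i - 1, by rw [← h2]; abel⟩
    · exact ⟨i + 1, by rw [← h1]; abel⟩
  have hall : ∀ j : Fin (m + 3), f 0 + j ∈ Set.range f := by
    intro j
    induction j using Fin.induction with
    | zero => simp
    | succ j ih => rw [← Fin.coeSucc_eq_succ, ← add_assoc]; exact hstep _ ih
  have hsurj : Function.Surjective f := by
    intro v
    have := hall (v - f 0)
    rwa [add_sub_cancel] at this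
  have := Fintype.card_le_of_surjective f hsurj
  simp at this
  omega

/-- The cycle on all `n > k` vertices is itself admissible. -/
theorem card_le_exFamily_of_lt {n k : ℕ} (hk : 2 ≤ k) (hkn : k < n) :
    n ≤ exFamily n (cycleFamily k) :=
  (card_le_ncard_edgeSet_cycleGraph (by omega)).trans
    ((girthExceeds_cycleGraph hkn).ncard_edgeSet_le (Fintype.card_fin n))

/-- A pendant vertex can be attached to an extremal graph: it has one neighbour, while a vertex on a
cycle has two, so no cycle is created. -/
theorem exFamily_add_one_le {n : ℕ} (hn : 0 < n) (k : ℕ) :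
    exFamily n (cycleFamily k) + 1 ≤ exFamily (n + 1) (cycleFamily k) := by
  obtain ⟨G, hG, hcard⟩ := exists_extremal_graph n k
  rw [← hcard]
  let v : Fin n := ⟨0, hn⟩
  let G' : SimpleGraph (Option (Fin n)) := G.map Function.Embedding.some ⊔ SimpleGraph.edge none (some v)
  have hadj : ∀ a b : Fin n, G'.Adj (some a) (some b) ↔ G.Adj a b := by
    intro a b
    simp only [G', SimpleGraph.edge_adj, SimpleGraph.map_adj, SimpleGraph.sup_adj]
    simp
  have hnone : ∀ a, G'.Adj none a → a = some v := by
    intro a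
    simp only [G', SimpleGraph.edge_adj, SimpleGraph.map_adj, SimpleGraph.sup_adj]
    simp
    tauto
  have hG' : GirthExceeds k G' := by
    intro l h3 hl ⟨f⟩
    obtain ⟨l, rfl⟩ : ∃ m, l = m + 3 := ⟨l - 3, by omega⟩
    by_cases hf : ∃ i, f i = none
    · obtain ⟨i, hi⟩ := hf
      have h1 : G'.Adj (f i) (f (i + 1)) :=
        f.toHom.map_adj (by simp [SimpleGraph.cycleGraph_adj])
      have h2 : G'.Adj (f i) (f (i - 1)) :=
        f.toHom.map_adj (by simp [SimpleGraph.cycleGraph_adj])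
      rw [hi] at h1 h2
      exact Fin.add_one_ne_sub_one i (f.injective ((hnone _ h1).trans (hnone _ h2).symm))
    · push Not at hf
      choose g hg using fun i => Option.ne_none_iff_exists'.mp (hf i)
      refine hG _ h3 hl ⟨⟨⟨g, ?_⟩, ?_⟩⟩
      · intro a b hab
        rw [← hadj, ← hg, ← hg]
        exact f.toHom.map_adj hab
      · intro a b hab
        apply f.injective
        change g a = g b at hab
        change f a = f b
        rw [hg, hg, hab]
  have hle := hG'.ncard_edgeSet_le (n := n + 1) (by simp)
  refine le_trans ?_ hle
  have hnot : s(none, some v) ∉ Sym2.map some '' G.edgeSet := by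
    rintro ⟨e, -, he⟩
    have : none ∈ Sym2.map some e := by rw [he]; simp
    simp at this
  rw [← Set.ncard_image_of_injective G.edgeSet (Sym2.map.injective (Option.some_injective _)),
    ← Set.ncard_insert_of_notMem hnot (Set.toFinite _)]
  refine Set.ncard_le_ncard ?_ (Set.toFinite _)
  intro e he
  rcases he with rfl | ⟨e, he, rfl⟩
  · simp [G']
  · induction e with
    | _ a b => exact (hadj a b).mpr he

theorem exFamily_add_le {n : ℕ} (hn : 0 < n) (k m : ℕ) :
    exFamily n (cycleFamily k) + m ≤ exFamily (n + m) (cycleFamily k) := by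
  induction m with
  | zero => rfl
  | succ m ih =>
    have := exFamily_add_one_le (n := n + m) (by omega) k
    rw [← add_assoc, ← add_assoc]
    omega

theorem GirthExceeds.isAcyclic {V : Type*} [Fintype V] {k : ℕ} {G : SimpleGraph V}
    (hG : GirthExceeds k G) (hk : Fintype.card V ≤ k) : G.IsAcyclic := by
  rw [SimpleGraph.isAcyclic_iff_free_cycleGraph]
  rintro l h3 ⟨f⟩
  have hl : l ≤ Fintype.card V := by
    simpa using Fintype.card_le_of_injective f f.injective
  exact hG l h3 (hl.trans hk) ⟨f⟩

theorem exFamily_lt_of_le {n k : ℕ} (hn : 0 < n) (hnk : n ≤ k) :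
    exFamily n (cycleFamily k) < n := by
  obtain ⟨G, hG, hcard⟩ := exists_extremal_graph n k
  have : Nonempty (Fin n) := ⟨⟨0, hn⟩⟩
  simpa [hcard] using (hG.isAcyclic (by simpa using hnk)).ncard_edgeSet_lt

theorem GirthExceeds.ncard_edgeSet_induce_lt {V : Type*} {k : ℕ} {G : SimpleGraph V}
    (hG : GirthExceeds k G) {A : Finset V} (hne : A.Nonempty) (hA : A.card ≤ k) :
    (G.induce (A : Set V)).edgeSet.ncard < A.card := by
  have : Nonempty (A : Set V) := hne.to_subtype
  have h := hG.of_isContained ⟨(SimpleGraph.Embedding.induce (G := G) (A : Set V)).toCopy⟩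
  simpa using (h.isAcyclic (by simpa using hA)).ncard_edgeSet_lt

/-! ### Locally sparse multigraphs -/

section Multigraph

variable {E V : Type*} [DecidableEq V]

/-- The edges of the multigraph `(D, s, t)` with both ends in `A`. -/
def edgesWithin (D : Finset E) (s t : E → V) (A : Finset V) : Finset E :=
  D.filter fun e => s e ∈ A ∧ t e ∈ A

variable {D : Finset E} {s t : E → V}

theorem mem_edgesWithin {A : Finset V} {e : E} :
    e ∈ edgesWithin D s t A ↔ e ∈ D ∧ s e ∈ A ∧ t e ∈ A := by
  simp [edgesWithin]

theorem edgesWithin_mono {A B : Finset V} (h : A ⊆ B) :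
    edgesWithin D s t A ⊆ edgesWithin D s t B := by
  intro e
  simp only [mem_edgesWithin]
  exact fun ⟨h1, h2, h3⟩ => ⟨h1, h h2, h h3⟩

/-- `A` is a union of connected components of the multigraph induced on `U`. -/
def IsUnionOfComponents (D : Finset E) (s t : E → V) (U A : Finset V) : Prop :=
  A ⊆ U ∧ ∀ e ∈ edgesWithin D s t U, s e ∈ A ↔ t e ∈ A

theorem IsUnionOfComponents.sdiff {U A : Finset V} (h : IsUnionOfComponents D s t U A) :
    IsUnionOfComponents D s t U (U \ A) := by
  refine ⟨Finset.sdiff_subset, fun e he => ?_⟩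
  have h1 := h.2 e he
  rw [mem_edgesWithin] at he
  simp [he.2.1, he.2.2, h1]

theorem IsUnionOfComponents.inter {U A B : Finset V} (h : IsUnionOfComponents D s t U A)
    (h' : IsUnionOfComponents D s t U B) : IsUnionOfComponents D s t U (A ∩ B) := by
  refine ⟨Finset.inter_subset_left.trans h.1, fun e he => ?_⟩
  simp [h.2 e he, h'.2 e he]

theorem IsUnionOfComponents.restrict {U A B : Finset V} (h : IsUnionOfComponents D s t U A)
    (hAB : A ⊆ B) (hBU : B ⊆ U) : IsUnionOfComponents D s t B A :=
  ⟨hAB, fun e he => h.2 e (edgesWithin_mono hBU he)⟩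

theorem IsUnionOfComponents.card_edgesWithin {U A : Finset V}
    (h : IsUnionOfComponents D s t U A) :
    (edgesWithin D s t U).card =
      (edgesWithin D s t A).card + (edgesWithin D s t (U \ A)).card := by
  classical
  rw [← Finset.card_union_of_disjoint]
  · congr 1
    ext e
    have h2 := h.2 e
    have hs := @h.1 (s e)
    have ht := @h.1 (t e)
    simp only [mem_edgesWithin, Finset.mem_union, Finset.mem_sdiff] at *
    tauto
  · rw [Finset.disjoint_left]
    intro e
    simp only [mem_edgesWithin, Finset.mem_sdiff]
    tauto

theorem card_edgesWithin_lt_insert {A : Finset V} {e : E} {x : V} (he : e ∈ D)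
    (hx : x ∉ A) (h : s e = x ∧ t e ∈ insert x A ∨ s e ∈ insert x A ∧ t e = x) :
    (edgesWithin D s t A).card < (edgesWithin D s t (insert x A)).card := by
  refine Finset.card_lt_card (Finset.ssubset_iff_subset_ne.mpr
    ⟨edgesWithin_mono (Finset.subset_insert _ _), fun heq => ?_⟩)
  have h1 : e ∈ edgesWithin D s t (insert x A) := by
    rw [mem_edgesWithin]
    rcases h with ⟨h1, h2⟩ | ⟨h1, h2⟩
    · exact ⟨he, by simp [h1], h2⟩
    · exact ⟨he, h1, by simp [h2]⟩
  rw [← heq, mem_edgesWithin] at h1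
  rcases h with ⟨h2, -⟩ | ⟨-, h2⟩
  · exact hx (h2 ▸ h1.2.1)
  · exact hx (h2 ▸ h1.2.2)

/-- If no `k` vertices span `k` edges, a set of at most `k` vertices that spans at least as many
edges extends to a union of fewer than `k` vertices in components with equally many edges. -/
theorem exists_isUnionOfComponents_of_card_le {k : ℕ} {U A : Finset V}
    (hk : ∀ B ⊆ U, B.card = k → (edgesWithin D s t B).card < k) (hU : k ≤ U.card)
    (hAU : A ⊆ U) (hAk : A.card ≤ k) (hA : A.card ≤ (edgesWithin D s t A).card) :
    ∃ B, A ⊆ B ∧ IsUnionOfComponents D s t U B ∧ B.card < k ∧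
      (edgesWithin D s t B).card = B.card := by
  classical
  let F := U.powerset.filter fun B => A ⊆ B ∧ B.card ≤ k ∧ B.card ≤ (edgesWithin D s t B).card
  obtain ⟨B, hBF, hmax⟩ := F.exists_max_image Finset.card
    ⟨A, by simp [F, hAU, hAk, hA]⟩
  simp only [F, Finset.mem_filter, Finset.mem_powerset] at hBF hmax
  obtain ⟨hBU, hAB, hBk, hB⟩ := hBF
  have hlt : B.card < k := by
    refine lt_of_le_of_ne hBk fun h => ?_
    have := hk B hBU h
    omega
  -- As `B.card < k`, enlarging `B` by one vertex keeps the size within `k`, so maximality can only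
  -- fail the edge count. Thus a further vertex brings no new edge: `B` is closed under adjacency
  -- and spans exactly `B.card` edges.
  have hmax' : ∀ x ∈ U, x ∉ B →
      (edgesWithin D s t (insert x B)).card ≤ B.card := by
    intro x hxU hx
    by_contra! hlt'
    have hc := Finset.card_insert_of_notMem hx
    have := hmax (insert x B) ⟨Finset.insert_subset hxU hBU,
      hAB.trans (Finset.subset_insert _ _), by omega, by omega⟩
    omega
  refine ⟨B, hAB, ⟨hBU, fun e he => ?_⟩, hlt, ?_⟩
  · rw [mem_edgesWithin] at he
    constructor
    · intro h
      by_contra hn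
      have := card_edgesWithin_lt_insert (s := s) (t := t) (A := B) he.1 hn
        (Or.inr ⟨Finset.mem_insert_of_mem h, rfl⟩)
      have := hmax' _ he.2.2 hn
      omega
    · intro h
      by_contra hn
      have := card_edgesWithin_lt_insert (s := s) (t := t) (A := B) he.1 hn
        (Or.inl ⟨rfl, Finset.mem_insert_of_mem h⟩)
      have := hmax' _ he.2.1 hn
      omega
  · obtain ⟨x, hxU, hx⟩ : ∃ x ∈ U, x ∉ B := by
      by_contra! h
      have := Finset.card_le_card (show U ⊆ B from h)
      omega
    have h1 := hmax' x hxU hx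
    have h2 := Finset.card_le_card
      (edgesWithin_mono (D := D) (s := s) (t := t) (Finset.subset_insert x B))
    omega

/-- A multigraph in which every vertex has degree at least `2` has at least as many edges as
vertices, and so has every union of components. -/
theorem IsUnionOfComponents.card_le_of_two_le_degree {U A : Finset V} (hloop : ∀ e ∈ D, s e ≠ t e)
    (hdeg : ∀ x ∈ U, (edgesWithin D s t (U.erase x)).card + 2 ≤ (edgesWithin D s t U).card)
    (h : IsUnionOfComponents D s t U A) : A.card ≤ (edgesWithin D s t A).card := by
  classical
  have hx : ∀ x ∈ A, 2 ≤ ((edgesWithin D s t A).filter fun e => s e = x).card +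
      ((edgesWithin D s t A).filter fun e => t e = x).card := by
    intro x hxA
    have h1 := hdeg x (h.1 hxA)
    rw [← Finset.card_union_of_disjoint]
    · have hsub : edgesWithin D s t U ⊆ edgesWithin D s t (U.erase x) ∪
          ((edgesWithin D s t A).filter (fun e => s e = x) ∪
            (edgesWithin D s t A).filter fun e => t e = x) := by
        intro e he
        have h2 := h.2 e he
        simp only [mem_edgesWithin, Finset.mem_union, Finset.mem_filter, Finset.mem_erase] at *
        by_cases hsx : s e = x
        · have : s e ∈ A := hsx ▸ hxA
          tauto
        · by_cases htx : t e = x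
          · have : t e ∈ A := htx ▸ hxA
            tauto
          · tauto
      have := (Finset.card_le_card hsub).trans (Finset.card_union_le _ _)
      omega
    · rw [Finset.disjoint_left]
      intro e he he'
      rw [Finset.mem_filter] at he he'
      exact hloop e (mem_edgesWithin.mp he.1).1 (he.2.trans he'.2.symm)
  have h1 := Finset.sum_le_sum hx
  rw [Finset.sum_add_distrib,
    ← Finset.card_eq_sum_card_fiberwise (f := s) (fun e he => (mem_edgesWithin.mp he).2.1),
    ← Finset.card_eq_sum_card_fiberwise (f := t) (fun e he => (mem_edgesWithin.mp he).2.2)] at h1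
  simp at h1
  omega

/-- A multigraph on `U` none of whose nonempty sets of at most `k` vertices spans as many edges
as it has vertices is a simple graph without cycles of length at most `k`. -/
theorem card_edgesWithin_le_exFamily_of_sparse {k : ℕ} {U : Finset V} (hk : 2 ≤ k)
    (hloop : ∀ e ∈ D, s e ≠ t e)
    (hsparse : ∀ A ⊆ U, A.Nonempty → A.card ≤ k → (edgesWithin D s t A).card < A.card) :
    (edgesWithin D s t U).card ≤ exFamily U.card (cycleFamily k) := by
  classical
  let G : SimpleGraph U :=
    { Adj := fun a b => ∃ e ∈ D, s(s e, t e) = s((a : V), (b : V))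
      symm := ⟨fun a b ⟨e, he, h⟩ => ⟨e, he, h.trans Sym2.eq_swap⟩⟩
      loopless := ⟨fun a ⟨e, he, h⟩ => hloop e he (by
        rcases Sym2.eq_iff.mp h with h | h <;> exact h.1.trans h.2.symm)⟩ }
  have hG : GirthExceeds k G := by
    rintro l h3 hl ⟨f⟩
    obtain ⟨l, rfl⟩ : ∃ m, l = m + 3 := ⟨l - 3, by omega⟩
    let g : Fin (l + 3) → V := fun i => f i
    have hg : Function.Injective g := Subtype.val_injective.comp f.injective
    have hadj : ∀ i, ∃ e ∈ D, s(s e, t e) = s(g i, g (i + 1)) := fun i =>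
      f.toHom.map_adj (v := i) (w := i + 1) (by simp [SimpleGraph.cycleGraph_adj])
    choose e heD he using hadj
    -- Two positions carrying the same edge in opposite directions would give `i + 1 = i - 1`,
    -- impossible on a cycle of length at least `3`.
    have hinj : Function.Injective e := by
      intro i j hij
      have h1 : s(g i, g (i + 1)) = s(g j, g (j + 1)) := by rw [← he, ← he, hij]
      rcases Sym2.eq_iff.mp h1 with h | h
      · exact hg h.1
      · have h2 := hg h.1
        have h3 := hg h.2
        exact absurd (show i + 1 = i - 1 by rw [h3, h2]; abel) (Fin.add_one_ne_sub_one i)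
    let A : Finset V := Finset.univ.image g
    have hA : A.card = l + 3 := by
      rw [Finset.card_image_of_injective _ hg]; simp
    have hAU : A ⊆ U := by
      intro x hx
      obtain ⟨i, -, rfl⟩ := Finset.mem_image.mp hx
      exact (f i).2
    have hgA : ∀ i, g i ∈ A := fun i => Finset.mem_image_of_mem _ (Finset.mem_univ i)
    have hlt := hsparse A hAU (Finset.card_pos.mp (by omega)) (by omega)
    have hsub : Finset.univ.image e ⊆ edgesWithin D s t A := by
      intro x hx
      obtain ⟨i, -, rfl⟩ := Finset.mem_image.mp hx
      rw [mem_edgesWithin]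
      refine ⟨heD i, ?_⟩
      rcases Sym2.eq_iff.mp (he i) with h | h
      · exact ⟨h.1 ▸ hgA _, h.2 ▸ hgA _⟩
      · exact ⟨h.1 ▸ hgA _, h.2 ▸ hgA _⟩
    have := Finset.card_le_card hsub
    rw [Finset.card_image_of_injective _ hinj] at this
    simp at this
    omega
  refine le_trans ?_ (hG.ncard_edgeSet_le (Fintype.card_coe U))
  rw [← Set.ncard_image_of_injective G.edgeSet (Sym2.map.injective Subtype.val_injective),
    ← Set.ncard_coe_finset]
  refine Set.ncard_le_ncard_of_injOn (fun e => s(s e, t e)) ?_ ?_ (Set.toFinite _)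
  · intro e he
    have he' := mem_edgesWithin.mp he
    exact ⟨s(⟨s e, he'.2.1⟩, ⟨t e, he'.2.2⟩), ⟨e, he'.1, rfl⟩, rfl⟩
  -- Parallel edges would be two edges on at most `2 ≤ k` vertices, against sparsity.
  · intro e he e' he' h
    by_contra hne
    have h1 := mem_edgesWithin.mp he
    have h2 := mem_edgesWithin.mp he'
    have hlt := hsparse {s e, t e} (by
      intro x hx
      rcases Finset.mem_insert.mp hx with rfl | hx
      · exact h1.2.1
      · rw [Finset.mem_singleton.mp hx]; exact h1.2.2) ⟨s e, by simp⟩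
      (Finset.card_le_two.trans hk)
    have hsub : ({e, e'} : Finset E) ⊆ edgesWithin D s t {s e, t e} := by
      intro x hx
      rcases Finset.mem_insert.mp hx with rfl | hx
      · simp [mem_edgesWithin, h1.1]
      · rw [Finset.mem_singleton.mp hx, mem_edgesWithin]
        refine ⟨h2.1, ?_⟩
        rcases Sym2.eq_iff.mp h with h | h <;> simp [← h.1, ← h.2]
    have h3 := Finset.card_le_card hsub
    rw [Finset.card_pair hne] at h3
    have h4 : ({s e, t e} : Finset V).card ≤ 2 := Finset.card_le_two
    omega

/-- A loopless multigraph on at least `k ≥ 2` vertices such that no `k` vertices span `k` edges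
has at most as many edges as some simple graph without cycles of length at most `k`. -/
theorem card_edgesWithin_le_exFamily {k : ℕ} (hk2 : 2 ≤ k) (hloop : ∀ e ∈ D, s e ≠ t e)
    (U : Finset V) (hU : k ≤ U.card)
    (hk : ∀ B ⊆ U, B.card = k → (edgesWithin D s t B).card < k) :
    (edgesWithin D s t U).card ≤ exFamily U.card (cycleFamily k) := by
  classical
  induction hm : U.card using Nat.strong_induction_on generalizing U with
  | _ m ih =>
  subst hm
  rcases hU.eq_or_lt with heq | hlt
  · have h1 := hk U subset_rfl heq.symm
    have h2 := card_le_exFamily_add_one U.card k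
    omega
  -- A vertex of degree at most `1` is deleted and paid for by a pendant vertex. Afterwards all
  -- degrees are at least `2`.
  by_cases hdeg : ∃ x ∈ U, (edgesWithin D s t U).card ≤ (edgesWithin D s t (U.erase x)).card + 1
  · obtain ⟨x, hx, hle⟩ := hdeg
    have hc := Finset.card_erase_of_mem hx
    have h1 := ih _ (by omega) (U.erase x) (by omega)
      (fun B hB => hk B (hB.trans (Finset.erase_subset _ _))) rfl
    have h2 := exFamily_add_one_le (n := (U.erase x).card) (by omega) k
    rw [show (U.erase x).card + 1 = U.card by omega] at h2
    omega
  replace hdeg : ∀ x ∈ U,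
      (edgesWithin D s t (U.erase x)).card + 2 ≤ (edgesWithin D s t U).card := by
    intro x hx
    by_contra h
    exact hdeg ⟨x, hx, by omega⟩
  by_cases hsparse : ∀ A ⊆ U, A.Nonempty → A.card ≤ k → (edgesWithin D s t A).card < A.card
  · exact card_edgesWithin_le_exFamily_of_sparse hk2 hloop hsparse
  push Not at hsparse
  obtain ⟨A, hAU, hAne, hAk, hA⟩ := hsparse
  obtain ⟨B, hAB, hB, hBk, hBe⟩ := exists_isUnionOfComponents_of_card_le hk hU hAU hAk hA
  have hsplit := hB.card_edgesWithin
  have hcard := Finset.card_sdiff_add_card_eq_card hB.1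
  have hBpos := (hAne.mono hAB).card_pos
  -- The union of components `B` has as many edges as vertices. If enough vertices remain, induct on
  -- the rest and replace `B` by pendant vertices.
  by_cases hUB : k ≤ (U \ B).card
  · have h1 := ih _ (by omega) (U \ B) hUB
      (fun C hC => hk C (hC.trans Finset.sdiff_subset)) rfl
    have h2 := exFamily_add_le (n := (U \ B).card) (by omega) k B.card
    rw [hcard] at h2
    omega
  -- Otherwise it suffices that `U` spans at most `U.card` edges, the number in a spanning cycle. If
  -- the fewer than `k` vertices of `U \ B` spanned too many, add a vertex of `B` and extend to a
  -- union of components `C` with `C.card` edges. But `U \ B` contributes a surplus to `C`, and the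
  -- rest of `C` no deficit since all degrees are at least `2`.
  have hlast := card_le_exFamily_of_lt hk2 hlt
  suffices (edgesWithin D s t (U \ B)).card ≤ (U \ B).card by omega
  by_contra! hgt
  obtain ⟨x, hx⟩ := hAne.mono hAB
  have hxn : x ∉ U \ B := by simp [hx]
  have hc := Finset.card_insert_of_notMem hxn
  have hmono := Finset.card_le_card
    (edgesWithin_mono (D := D) (s := s) (t := t) (Finset.subset_insert x (U \ B)))
  obtain ⟨C, hC1, hC, hCk, hCe⟩ := exists_isUnionOfComponents_of_card_le hk hU
    (A := insert x (U \ B)) (Finset.insert_subset (hB.1 hx) Finset.sdiff_subset)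
    (by omega) (by omega)
  have hsub := (Finset.subset_insert x (U \ B)).trans hC1
  have h1 := (hB.sdiff.restrict hsub hC.1).card_edgesWithin
  have h2 := (hC.inter hB.sdiff.sdiff).card_le_of_two_le_degree hloop hdeg
  have h3 : C ∩ (U \ (U \ B)) = C \ (U \ B) := by
    ext y
    have := @hC.1 y
    simp only [Finset.mem_inter, Finset.mem_sdiff]
    tauto
  rw [h3] at h2
  have h4 := Finset.card_sdiff_add_card_eq_card hsub
  omega

end Multigraph

/-! ### Recovery sets and forced zeros -/

theorem exists_ne_zero_of_card_lt_finrank {F ι : Type*} [Field F] [Finite ι]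
    (C : Submodule F (ι → F)) (T : Finset ι) (h : T.card < Module.finrank F C) :
    ∃ c ∈ C, c ≠ 0 ∧ ∀ i ∈ T, c i = 0 := by
  let φ : C →ₗ[F] (T → F) := (LinearMap.funLeft F F ((↑) : T → ι)).comp C.subtype
  have hker : LinearMap.ker φ ≠ ⊥ := LinearMap.ker_ne_bot_of_finrank_lt (by simpa using h)
  obtain ⟨c, hc, hne⟩ := Submodule.exists_mem_ne_zero_of_ne_bot hker
  refine ⟨c, c.2, by simpa using hne, fun i hi => ?_⟩
  exact congrFun (LinearMap.mem_ker.mp hc) ⟨i, hi⟩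

theorem finrank_le_card_of_forall_eq_zero {F ι : Type*} [Field F] [Finite ι]
    (C : Submodule F (ι → F)) (T : Finset ι) (h : ∀ c ∈ C, (∀ i ∈ T, c i = 0) → c = 0) :
    Module.finrank F C ≤ T.card := by
  by_contra! hlt
  obtain ⟨c, hc, hne, hT⟩ := exists_ne_zero_of_card_lt_finrank C T hlt
  exact hne (h c hc hT)

/-- A family of `m` recovery sets `S i` of size exactly `r + 1`, the `i`-th one recovering the
coordinate `x i`, which lies in no earlier recovery set. -/
structure IsRecoverySystem {F : Type} [Field F] {n : ℕ} (r m : ℕ) (C : Submodule F (Fin n → F))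
    (S : ℕ → Finset (Fin n)) (x : ℕ → Fin n) : Prop where
  card_eq : ∀ i < m, (S i).card = r + 1
  mem : ∀ i < m, x i ∈ S i
  notMem : ∀ j < m, ∀ i < j, x j ∉ S i
  recover : ∀ i < m, ∀ c ∈ C, (∀ y ∈ S i, y ≠ x i → c y = 0) → c (x i) = 0

/-- Greedy choice: before the last step fewer than `n` coordinates are covered, so an uncovered one
exists. Padding its recovery set to size `r + 1` preserves the vanishing implication. -/
theorem IsLRC.exists_isRecoverySystem {F : Type} [Field F] {n k r : ℕ}
    {C : Submodule F (Fin n → F)} (hC : IsLRC k r C) (hrn : r + 1 ≤ n) (m : ℕ)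
    (hm : m * (r + 1) < n + (r + 1)) :
    ∃ S x, IsRecoverySystem r m C S x := by
  classical
  induction m with
  | zero =>
    exact ⟨fun _ => ∅, fun _ => ⟨0, by omega⟩, by simp, by simp, by simp, by simp⟩
  | succ m ih =>
    rw [add_mul, one_mul] at hm
    obtain ⟨S, x, h⟩ := ih (by omega)
    obtain ⟨y, hy⟩ : ∃ y, y ∉ (Finset.range m).biUnion S := by
      by_contra! hall
      have h1 : (Finset.univ : Finset (Fin n)).card ≤ _ :=
        Finset.card_le_card (fun y _ => hall y)
      have h2 := Finset.card_biUnion_le_card_mul (Finset.range m) S (r + 1)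
        (fun i hi => (h.card_eq i (Finset.mem_range.mp hi)).le)
      simp at h1 h2
      omega
    obtain ⟨R, a, hyR, hR, hrec⟩ := hC.2 y
    obtain ⟨T, hT, hTc⟩ := Finset.exists_superset_card_eq (s := insert y R) (n := r + 1)
      (by rw [Finset.card_insert_of_notMem hyR]; omega) (by simpa using hrn)
    refine ⟨fun i => if i = m then T else S i, fun i => if i = m then y else x i, ?_, ?_, ?_, ?_⟩
    · intro i hi
      by_cases him : i = m
      · simp [him, hTc]
      · simp [him, h.card_eq i (by omega)]
    · intro i hi
      by_cases him : i = m
      · simp [him, hT (Finset.mem_insert_self _ _)]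
      · simp [him, h.mem i (by omega)]
    · intro j hj i hij
      have him : i ≠ m := by omega
      by_cases hjm : j = m
      · simp only [him, hjm, if_true, if_false]
        intro hmem
        exact hy (Finset.mem_biUnion.mpr ⟨i, Finset.mem_range.mpr (by omega), hmem⟩)
      · simp [him, hjm, h.notMem j (by omega) i hij]
    · intro i hi c hc
      by_cases him : i = m
      · simp only [him, if_true]
        intro hz
        rw [hrec c hc]
        refine Finset.sum_eq_zero fun j hj => ?_
        rw [hz j (hT (Finset.mem_insert_of_mem hj)) (fun h => hyR (h ▸ hj)), mul_zero]
      · simp only [him, if_false]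
        exact h.recover i (by omega) c hc

section RecoverySystem

variable {F : Type} [Field F] {n r m : ℕ} {C : Submodule F (Fin n → F)}
  {S : ℕ → Finset (Fin n)} {x : ℕ → Fin n}

theorem IsRecoverySystem.injOn (h : IsRecoverySystem r m C S x) :
    Set.InjOn x (Finset.range m) := by
  intro i hi j hj hij
  simp only [Finset.coe_range, Set.mem_Iio] at hi hj
  rcases lt_trichotomy i j with hlt | heq | hlt
  · exact absurd (hij ▸ h.mem i hi) (h.notMem j hj i hlt)
  · exact heq
  · exact absurd (hij ▸ h.mem j hj) (h.notMem i hi j hlt)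

/-- Induction on `i`: any other recovered coordinate `x j` lying in `S i` has `j < i`, so it is
already known to vanish. -/
theorem IsRecoverySystem.eq_zero (h : IsRecoverySystem r m C S x) {A : Finset ℕ}
    (hA : A ⊆ Finset.range m) {c : Fin n → F} (hc : c ∈ C)
    (hz : ∀ y ∈ A.biUnion S, y ∉ A.image x → c y = 0) : ∀ i ∈ A, c (x i) = 0 := by
  intro i
  induction i using Nat.strong_induction_on with
  | _ i ih =>
  intro hi
  refine h.recover i (Finset.mem_range.mp (hA hi)) c hc fun y hy hyx => ?_
  by_cases hyA : y ∈ A.image x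
  · obtain ⟨j, hj, rfl⟩ := Finset.mem_image.mp hyA
    rcases lt_trichotomy i j with hlt | rfl | hlt
    · exact absurd hy (h.notMem j (Finset.mem_range.mp (hA hj)) i hlt)
    · exact absurd rfl hyx
    · exact ih j hlt hj
  · exact hz y (Finset.mem_biUnion.mpr ⟨i, hi, hy⟩) hyA

/-- If `t` recovery sets cover fewer than `dim C + t` coordinates, some nonzero codeword vanishes
on `dim C - 1 + t` coordinates. -/
theorem IsRecoverySystem.exists_hammingNorm_add_le [DecidableEq F] (h : IsRecoverySystem r m C S x)
    {A : Finset ℕ} (hA : A ⊆ Finset.range m)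
    (hcard : (A.biUnion S).card < Module.finrank F C + A.card) :
    ∃ c ∈ C, c ≠ 0 ∧ hammingNorm c + Module.finrank F C + A.card ≤ n + 1 := by
  classical
  have hI : (A.image x).card = A.card :=
    Finset.card_image_of_injOn (h.injOn.mono (by exact_mod_cast hA))
  have hIU : A.image x ⊆ A.biUnion S := by
    intro y hy
    obtain ⟨i, hi, rfl⟩ := Finset.mem_image.mp hy
    exact Finset.mem_biUnion.mpr ⟨i, hi, h.mem i (Finset.mem_range.mp (hA hi))⟩
  have hT := Finset.card_sdiff_add_card_eq_card hIU
  have hIc := Finset.card_add_card_compl (A.image x)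
  rw [Fintype.card_fin] at hIc
  have hsub : A.biUnion S \ A.image x ⊆ (A.image x)ᶜ := by
    intro y
    simp
  have hzero : ∀ T, A.biUnion S \ A.image x ⊆ T → ∀ c ∈ C, (∀ y ∈ T, c y = 0) →
      ∀ y ∈ T ∪ A.image x, c y = 0 := by
    intro T hT c hc hz y hy
    rcases Finset.mem_union.mp hy with hy | hy
    · exact hz y hy
    · obtain ⟨i, hi, rfl⟩ := Finset.mem_image.mp hy
      exact h.eq_zero hA hc (fun y hy hyn => hz y (hT (Finset.mem_sdiff.mpr ⟨hy, hyn⟩))) i hi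
  have hbig : Module.finrank F C ≤ (A.image x)ᶜ.card := by
    refine finrank_le_card_of_forall_eq_zero C _ fun c hc hz => ?_
    funext y
    exact hzero _ hsub c hc hz y
      (by rw [Finset.mem_union, Finset.mem_compl, or_comm]; exact em _)
  -- The covered coordinates that are not recovered number at most `dim C - 1`; `T` enlarges them to
  -- exactly that size outside the recovered ones. Vanishing on `T` then forces the `A.card` extra
  -- zeros.
  obtain ⟨T, hT1, hT2, hTc⟩ := Finset.exists_subsuperset_card_eq
    (n := Module.finrank F C - 1) hsub (by omega) (by omega)
  obtain ⟨c, hc, hne, hz⟩ := exists_ne_zero_of_card_lt_finrank C T (by omega)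
  refine ⟨c, hc, hne, ?_⟩
  have hz' := hzero T hT1 c hc hz
  have hdisj : Disjoint T (A.image x) := by
    rw [Finset.disjoint_left]
    exact fun y hy hyI => by simpa [hyI] using hT2 hy
  have hu := Finset.card_union_of_disjoint hdisj
  have hn : hammingNorm c ≤ (T ∪ A.image x)ᶜ.card := by
    refine Finset.card_le_card fun y hy => ?_
    rw [Finset.mem_compl]
    intro hyT
    simp [hz' y hyT] at hy
  have := Finset.card_add_card_compl (T ∪ A.image x)
  rw [Fintype.card_fin] at this
  omega

end RecoverySystem

open Classical in
theorem hasMinDistance_iff {F : Type} [Field F] {n : ℕ} {C : Submodule F (Fin n → F)} {d : ℕ} :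
    HasMinDistance C d ↔
      (∃ c ∈ C, c ≠ 0 ∧ hammingNorm c = d) ∧ ∀ c ∈ C, c ≠ 0 → d ≤ hammingNorm c := by
  have hset : {e : ℕ | ∃ x ∈ C, ∃ y ∈ C, x ≠ y ∧ hammingDist x y = e}
      = {e : ℕ | ∃ c ∈ C, c ≠ 0 ∧ hammingNorm c = e} := by
    ext e
    constructor
    · rintro ⟨x, hx, y, hy, hne, rfl⟩
      refine ⟨-x + y, C.add_mem (C.neg_mem hx) hy, ?_, (hammingDist_eq_hammingNorm x y).symm⟩
      rwa [neg_add_eq_sub, sub_ne_zero, ne_comm]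
    · rintro ⟨c, hc, hne, rfl⟩
      exact ⟨c, hc, 0, C.zero_mem, hne, hammingDist_zero_right c⟩
  unfold HasMinDistance
  rw [hset]
  constructor
  · rintro ⟨h1, h2⟩
    exact ⟨h1, fun c hc hne => h2 ⟨c, hc, hne, rfl⟩⟩
  · rintro ⟨h1, h2⟩
    refine ⟨h1, ?_⟩
    rintro _ ⟨c, hc, hne, rfl⟩
    exact h2 c hc hne

/-! ### From overlapping sets to a multigraph -/

/-- If `m` sets of size `q` are such that any `k` of them cover more than `k * q - k` points,
then all of them cover at least `m * q - ex(m, {C₃, …, C_k})` points. -/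
theorem mul_le_card_biUnion_add_exFamily {β : Type*} [DecidableEq β] (S : ℕ → Finset β)
    {m k q : ℕ} (hk2 : 2 ≤ k) (hkm : k ≤ m) (hS : ∀ i < m, (S i).card = q)
    (hunion : ∀ A ⊆ Finset.range m, A.card = k → k * q < (A.biUnion S).card + k) :
    m * q ≤ ((Finset.range m).biUnion S).card + exFamily m (cycleFamily k) := by
  classical
  -- `μ y` is the least index of a set containing `y`. Each other set `i` containing `y` yields an
  -- edge from `μ y` to `i`. The default `sInf ∅ = 0` is harmless: only covered points matter.
  let μ : β → ℕ := fun y => sInf {i | i < m ∧ y ∈ S i}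
  have hμ : ∀ y i, i < m → y ∈ S i → μ y < m ∧ y ∈ S (μ y) :=
    fun y i hi hy => Nat.sInf_mem (s := {i | i < m ∧ y ∈ S i}) ⟨i, hi, hy⟩
  let D : Finset (Σ _ : ℕ, β) := ((Finset.range m).sigma S).filter fun p => μ p.2 ≠ p.1
  let s : (Σ _ : ℕ, β) → ℕ := fun p => μ p.2
  let t : (Σ _ : ℕ, β) → ℕ := fun p => p.1
  have hsum : ∀ A ⊆ Finset.range m, (A.sigma S).card = A.card * q := by
    intro A hA
    rw [Finset.card_sigma, Finset.sum_const_nat fun i hi => hS i (Finset.mem_range.mp (hA hi))]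
  have hD : ∀ A ⊆ Finset.range m,
      edgesWithin D s t A = (A.sigma S).filter fun p => μ p.2 ≠ p.1 ∧ μ p.2 ∈ A := by
    intro A hA
    ext ⟨i, y⟩
    have := @hA i
    simp only [mem_edgesWithin, D, s, t, Finset.mem_filter, Finset.mem_sigma]
    tauto
  -- Only an inequality: if `μ y ∉ A`, repeated coverings of `y` inside `A` give no edge within `A`.
  -- For the full range `hge` supplies the converse.
  have hle : ∀ A ⊆ Finset.range m,
      (edgesWithin D s t A).card + (A.biUnion S).card ≤ A.card * q := by
    intro A hA
    rw [← hsum A hA, hD A hA,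
      ← Finset.card_filter_add_card_filter_not (s := A.sigma S)
        (fun p => μ p.2 ≠ p.1 ∧ μ p.2 ∈ A)]
    refine Nat.add_le_add_left ?_ _
    refine (Finset.card_le_card ?_).trans (Finset.card_image_le (f := Sigma.snd))
    intro y hy
    obtain ⟨i, hi, hyi⟩ := Finset.mem_biUnion.mp hy
    rw [Finset.mem_image]
    by_cases hμA : μ y ∈ A
    · exact ⟨⟨μ y, y⟩, by simp [hμA, (hμ y i (Finset.mem_range.mp (hA hi)) hyi).2], rfl⟩
    · exact ⟨⟨i, y⟩, by simp [hμA, hi, hyi], rfl⟩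
  have hge : m * q ≤ (edgesWithin D s t (Finset.range m)).card +
      ((Finset.range m).biUnion S).card := by
    have h0 := hsum _ (Finset.Subset.refl (Finset.range m))
    rw [Finset.card_range] at h0
    rw [← h0, hD _ subset_rfl,
      ← Finset.card_filter_add_card_filter_not (s := (Finset.range m).sigma S)
        (fun p => μ p.2 ≠ p.1 ∧ μ p.2 ∈ Finset.range m)]
    refine Nat.add_le_add_left ?_ _
    have hfix : ∀ p ∈ ((Finset.range m).sigma S).filter
        (fun p => ¬(μ p.2 ≠ p.1 ∧ μ p.2 ∈ Finset.range m)), p.2 ∈ S p.1 ∧ p.1 < m ∧ μ p.2 = p.1 := by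
      intro p hp
      rw [Finset.mem_filter, Finset.mem_sigma, Finset.mem_range, Finset.mem_range] at hp
      have := hμ p.2 p.1 hp.1.1 hp.1.2
      tauto
    refine Finset.card_le_card_of_injOn Sigma.snd (fun p hp => ?_) (fun p hp p' hp' h => ?_)
    · have := hfix p hp
      exact Finset.mem_coe.mpr (Finset.mem_biUnion.mpr ⟨p.1, Finset.mem_range.mpr this.2.1, this.1⟩)
    · have h1 := (hfix p hp).2.2
      have h2 := (hfix p' hp').2.2
      obtain ⟨i, y⟩ := p
      obtain ⟨j, z⟩ := p'
      simp only at h h1 h2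
      subst h
      rw [← h1, ← h2]
  have hmain := card_edgesWithin_le_exFamily (D := D) (s := s) (t := t) hk2
    (fun e he => (Finset.mem_filter.mp he).2) (Finset.range m) (by simpa using hkm)
    (fun B hB hBk => by
      have h1 := hle B hB
      have h2 := hunion B hB hBk
      rw [hBk] at h1
      omega)
  rw [Finset.card_range] at hmain
  omega

/-! ### The upper bound and necessity -/

theorem le_lrcK1_mul {r : ℕ} (hr : 1 ≤ r) (k : ℕ) : k ≤ lrcK1 k r * r := by
  rw [mul_comm]
  exact le_smul_ceilDiv (Nat.pos_of_ne_zero (by omega))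

theorem lrcK1_mul_lt {r : ℕ} (hr : 1 ≤ r) (k : ℕ) : lrcK1 k r * r < k + r := by
  rw [lrcK1, Nat.ceilDiv_eq_add_pred_div]
  have := Nat.div_mul_le_self (k + r - 1) r
  omega

theorem le_lrcN1_mul (n r : ℕ) : n ≤ lrcN1 n r * (r + 1) :=
  le_lrcK1_mul (Nat.succ_pos r) n

theorem lrcN1_mul_lt (n r : ℕ) : lrcN1 n r * (r + 1) < n + (r + 1) :=
  lrcK1_mul_lt (Nat.succ_pos r) n

/-- `k₁ - 1` recovery sets cover at most `(k₁ - 1) * (r + 1) < k + k₁ - 1` coordinates, because `(k₁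
- 1) * r < k`. -/
theorem IsLRC.le_lrcDStar {F : Type} [Field F] {n k r d : ℕ} {C : Submodule F (Fin n → F)}
    (hC : IsLRC k r C) (hd : HasMinDistance C d) (hr : 1 ≤ r) (hrn : r + 1 ≤ n) (hk : 1 ≤ k)
    (hn1 : lrcK1 k r ≤ lrcN1 n r) : (d : ℤ) ≤ lrcDStar n k r := by
  classical
  obtain ⟨S, x, h⟩ := hC.exists_isRecoverySystem hrn _ (lrcN1_mul_lt n r)
  have h1 := le_lrcK1_mul hr k
  have h2 := lrcK1_mul_lt hr k
  obtain ⟨K, hK⟩ : ∃ K, lrcK1 k r = K + 1 := by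
    refine ⟨lrcK1 k r - 1, ?_⟩
    rcases Nat.eq_zero_or_pos (lrcK1 k r) with h0 | h0
    · rw [h0] at h1
      omega
    · omega
  have hA : Finset.range K ⊆ Finset.range (lrcN1 n r) := Finset.range_subset_range.mpr (by omega)
  have hU := Finset.card_biUnion_le_card_mul (Finset.range K) S (r + 1)
    (fun i hi => (h.card_eq i (Finset.mem_range.mp (hA hi))).le)
  rw [hK] at h2
  rw [Finset.card_range] at hU
  obtain ⟨c, hc, hne, hle⟩ := h.exists_hammingNorm_add_le hA (by
    rw [hC.1, Finset.card_range]
    linarith)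
  rw [hC.1, Finset.card_range] at hle
  have hdc := (hasMinDistance_iff.mp hd).2 c hc hne
  have hle' : d + k + K ≤ n + 1 := by
    refine le_trans ?_ hle
    gcongr
  rw [lrcDStar, hK]
  push_cast
  omega

theorem IsLRC.lrcN2_le_exFamily {F : Type} [Field F] {n k r d : ℕ} {C : Submodule F (Fin n → F)}
    (hC : IsLRC k r C) (hd : HasMinDistance C d) (hdStar : (d : ℤ) = lrcDStar n k r)
    (hr : 1 ≤ r) (hrn : r + 1 ≤ n) (hn1 : lrcK1 k r ≤ lrcN1 n r)
    (hk1 : 3 ≤ lrcK1 k r) (hk2 : lrcK2 k r = lrcK1 k r - 1) :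
    lrcN2 n r ≤ exFamily (lrcN1 n r) (cycleFamily (lrcK1 k r)) := by
  classical
  obtain ⟨S, x, h⟩ := hC.exists_isRecoverySystem hrn _ (lrcN1_mul_lt n r)
  have h1 := le_lrcK1_mul hr k
  rw [lrcK2] at hk2
  have key := mul_le_card_biUnion_add_exFamily S (m := lrcN1 n r) (k := lrcK1 k r) (q := r + 1)
    (by omega) hn1 h.card_eq (fun A hA hAk => by
      by_contra! hU
      rw [mul_add, mul_one] at hU
      obtain ⟨c, hc, hne, hle⟩ := h.exists_hammingNorm_add_le hA (by rw [hC.1]; omega)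
      rw [hC.1] at hle
      have hdc := (hasMinDistance_iff.mp hd).2 c hc hne
      have hle' : d + k + A.card ≤ n + 1 := by
        refine le_trans ?_ hle
        gcongr
      rw [lrcDStar] at hdStar
      omega)
  have hcard := Finset.card_le_univ ((Finset.range (lrcN1 n r)).biUnion S)
  rw [Fintype.card_fin] at hcard
  rw [lrcN2]
  omega

/-! ### Subspaces in general position -/

/-- A proper subspace contains at most a `1 / |F|` fraction of `V`, so fewer than `|F|` of them
cannot cover it. -/
theorem exists_notMem_of_card_lt {F V κ : Type*} [Field F] [Finite F] [AddCommGroup V] [Module F V]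
    [FiniteDimensional F V] [Finite κ] (U : κ → Submodule F V) (hU : ∀ j, U j ≠ ⊤)
    (hκ : Nat.card κ < Nat.card F) : ∃ v, ∀ j, v ∉ U j := by
  classical
  by_contra! hcov
  have := Fintype.ofFinite κ
  have := Fintype.ofFinite F
  have : Finite V := Module.finite_of_finite F
  have := Fintype.ofFinite V
  rcases isEmpty_or_nonempty κ with hκe | ⟨⟨j0⟩⟩
  · obtain ⟨j, -⟩ := hcov 0
    exact hκe.elim j
  have hlt : ∀ j, Module.finrank F (U j) < Module.finrank F V := fun j =>
    Submodule.finrank_lt (hU j)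
  have hcard : ∀ j, (Finset.univ.filter (· ∈ U j)).card ≤
      Fintype.card F ^ (Module.finrank F V - 1) := by
    intro j
    rw [← Fintype.card_subtype]
    have : Fintype.card (U j) = _ := Module.card_eq_pow_finrank (K := F) (V := U j)
    refine le_trans this.le (Nat.pow_le_pow_right Fintype.card_pos ?_)
    have := hlt j
    omega
  have h1 : (Finset.univ : Finset V).card ≤ _ := Finset.card_le_card (t := Finset.univ.biUnion
    fun j => Finset.univ.filter (· ∈ U j)) (fun v _ => by simpa using hcov v)
  have h2 := Finset.card_biUnion_le_card_mul Finset.univ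
    (fun j => Finset.univ.filter (· ∈ U j)) _ (fun j _ => hcard j)
  rw [Finset.card_univ, Module.card_eq_pow_finrank (K := F) (V := V)] at h1
  have h3 : Fintype.card F ^ Module.finrank F V
      = Fintype.card F * Fintype.card F ^ (Module.finrank F V - 1) := by
    rw [← pow_succ', Nat.sub_add_cancel (by have := hlt j0; omega)]
  rw [h3] at h1
  have h4 := Nat.le_of_mul_le_mul_right (h1.trans h2) (pow_pos Fintype.card_pos _)
  rw [Nat.card_eq_fintype_card, Nat.card_eq_fintype_card] at hκ
  rw [Finset.card_univ] at h4
  omega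

/-- Over a large field there is a `k`-dimensional subspace in general position with respect to
finitely many subspaces of codimension at least `k`. -/
theorem exists_submodule_disjoint {F V κ : Type*} [Field F] [Finite F] [AddCommGroup V]
    [Module F V] [FiniteDimensional F V] [Finite κ] [Nonempty κ] (W : κ → Submodule F V)
    (hκ : Nat.card κ < Nat.card F) (k : ℕ)
    (hW : ∀ j, Module.finrank F (W j) + k ≤ Module.finrank F V) :
    ∃ C : Submodule F V, Module.finrank F C = k ∧ ∀ j, Disjoint C (W j) := by
  induction k with
  | zero => exact ⟨⊥, finrank_bot F V, fun j => disjoint_bot_left⟩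
  | succ k ih =>
    obtain ⟨C, hC, hdisj⟩ := ih fun j => by have := hW j; omega
    obtain ⟨v, hv⟩ := exists_notMem_of_card_lt (fun j => C ⊔ W j) (fun j htop => by
      have h1 := Submodule.finrank_add_le_finrank_add_finrank C (W j)
      rw [htop, finrank_top] at h1
      have := hW j
      omega) hκ
    obtain ⟨j0⟩ := ‹Nonempty κ›
    have hv0 : v ≠ 0 := fun h => hv j0 (h ▸ Submodule.zero_mem _)
    refine ⟨F ∙ v ⊔ C, ?_, fun j => ?_⟩
    · have h1 := Submodule.finrank_sup_add_finrank_inf_eq (F ∙ v) C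
      have h2 : Disjoint (F ∙ v) C := by
        rw [disjoint_comm, Submodule.disjoint_span_singleton' hv0]
        exact fun h => hv j0 (Submodule.mem_sup_left h)
      rw [h2.eq_bot, finrank_bot, finrank_span_singleton hv0, hC] at h1
      omega
    · refine (hdisj j).disjoint_sup_left_of_disjoint_sup_right ?_
      rw [disjoint_comm, Submodule.disjoint_span_singleton' hv0]
      exact hv j

/-! ### Relations among sparse parity checks -/

section Incidence

variable {β ι : Type*} [Fintype β] [DecidableEq β] [DecidableEq ι]

/-- The coordinates of the `i`-th group when the coordinate `y` lies in the groups `p y`, `q y`. -/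
def incidenceGroup (p q : β → ι) (i : ι) : Finset β :=
  Finset.univ.filter fun y => p y = i ∨ q y = i

/-- The coordinates lying in two groups. -/
def sharedCoords (p q : β → ι) : Finset β := Finset.univ.filter fun y => p y ≠ q y

variable {p q : β → ι}

/-- Double counting: a coordinate meeting `A` is counted twice exactly when it is shared and both
its groups lie in `A`. -/
theorem sum_card_incidenceGroup (A : Finset ι) :
    ∑ i ∈ A, (incidenceGroup p q i).card =
      (Finset.univ.filter fun y => p y ∈ A ∨ q y ∈ A).card +
        (edgesWithin (sharedCoords p q) p q A).card := by
  let X : Finset β := Finset.univ.filter fun y => p y ∈ A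
  let Y : Finset β := Finset.univ.filter fun y => q y ∈ A ∧ p y ≠ q y
  have hX : X.card = ∑ i ∈ A, (X.filter fun y => p y = i).card :=
    Finset.card_eq_sum_card_fiberwise fun y hy => (Finset.mem_filter.mp hy).2
  have hY : Y.card = ∑ i ∈ A, (Y.filter fun y => q y = i).card :=
    Finset.card_eq_sum_card_fiberwise fun y hy => (Finset.mem_filter.mp hy).2.1
  have hU : (Finset.univ.filter fun y => p y ∈ A ∨ q y ∈ A) = X ∪ Y := by
    ext y
    simp only [X, Y, Finset.mem_filter, Finset.mem_union, Finset.mem_univ, true_and]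
    by_cases h : p y = q y
    · simp [h]
    · tauto
  have hI : edgesWithin (sharedCoords p q) p q A = X ∩ Y := by
    ext y
    simp only [X, Y, mem_edgesWithin, sharedCoords, Finset.mem_filter, Finset.mem_inter,
      Finset.mem_univ, true_and]
    tauto
  rw [hU, hI, Finset.card_union_add_card_inter, hX, hY, ← Finset.sum_add_distrib]
  refine Finset.sum_congr rfl fun i hi => ?_
  rw [← Finset.card_union_of_disjoint]
  · congr 1
    ext y
    simp only [X, Y, incidenceGroup, Finset.mem_filter, Finset.mem_union, Finset.mem_univ, true_and]
    constructor
    · rintro (rfl | rfl)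
      · exact Or.inl ⟨hi, rfl⟩
      · by_cases h : p y = q y
        · exact Or.inl ⟨h ▸ hi, h⟩
        · exact Or.inr ⟨⟨hi, h⟩, rfl⟩
    · tauto
  · rw [Finset.disjoint_left]
    intro y
    simp only [X, Y, Finset.mem_filter, Finset.mem_univ, true_and]
    rintro ⟨-, rfl⟩ ⟨⟨-, h⟩, h'⟩
    exact h h'.symm

/-- An arrangement of coordinates into groups of size `r + 1` whose overlaps form a simple graph
with at most `r` edges in which no `K` vertices span `K` edges. -/
structure IsSparseIncidence (r K : ℕ) (p q : β → ι) : Prop where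
  card_group : ∀ i, (incidenceGroup p q i).card = r + 1
  inj : ∀ y z, p y ≠ q y → s(p y, q y) = s(p z, q z) → y = z
  sparse : ∀ A : Finset ι, A.card = K → (edgesWithin (sharedCoords p q) p q A).card < K
  card_shared : (sharedCoords p q).card ≤ r

/-- `L` stands for the relations among the checks restricted to the complement of `T`. Its support
`J` is nearly confined to `T`: a coordinate meeting `J` outside `T` must be an edge within `J`, and
each such edge costs `L` a dimension (at least two for two edges, by simplicity). Counting
incidences then contradicts `K ≤ dim L`. -/
theorem IsSparseIncidence.finrank_lt [Fintype ι] {F : Type*} [Field F] {r K : ℕ}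
    (h : IsSparseIncidence r K p q)
    (hK : 1 ≤ K) {T : Finset β} (hT : T.card = K * r) (L : Submodule F (ι → F))
    (hpriv : ∀ l ∈ L, ∀ y ∉ T, p y = q y → l (p y) = 0)
    (hshared : ∀ l ∈ L, ∀ y ∉ T, p y ≠ q y → l (p y) + l (q y) = 0) :
    Module.finrank F L < K := by
  classical
  by_contra! hL
  let J : Finset ι := Finset.univ.filter fun i => ∃ l ∈ L, l i ≠ 0
  have hJ : ∀ i, i ∉ J → ∀ l ∈ L, l i = 0 := by
    intro i hi l hl
    by_contra hne
    exact hi (by simpa [J] using ⟨l, hl, hne⟩)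
  have hLJ := finrank_le_card_of_forall_eq_zero L J fun l hl hz => by
    funext i
    by_cases hi : i ∈ J
    · exact hz i hi
    · exact hJ i hi l hl
  let E := edgesWithin (sharedCoords p q) p q J
  have hE : E.card ≤ r := (Finset.card_le_card (Finset.filter_subset _ _)).trans h.card_shared
  have hET : (E \ T).card ≤ E.card := Finset.card_le_card Finset.sdiff_subset
  have hcover : (Finset.univ.filter fun y => p y ∈ J ∨ q y ∈ J) ⊆ T ∪ E \ T := by
    intro y hy
    rw [Finset.mem_filter] at hy
    rw [Finset.union_sdiff_self_eq_union, Finset.mem_union]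
    by_contra! hn
    obtain ⟨hyT, hyE⟩ := hn
    by_cases hpq : p y = q y
    · have hz : ∀ l ∈ L, l (p y) = 0 := fun l hl => hpriv l hl y hyT hpq
      have hpJ : p y ∈ J := by
        rcases hy.2 with h | h
        · exact h
        · exact hpq ▸ h
      simp only [J, Finset.mem_filter] at hpJ
      obtain ⟨-, l, hl, hne⟩ := hpJ
      exact hne (hz l hl)
    · have hz : ∀ l ∈ L, l (p y) + l (q y) = 0 := fun l hl => hshared l hl y hyT hpq
      have hnot : ¬(p y ∈ J ∧ q y ∈ J) := fun hh =>
        hyE (mem_edgesWithin.mpr ⟨by simp [sharedCoords, hpq], hh⟩)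
      rcases hy.2 with hp | hq
      · have hqn : q y ∉ J := fun hq => hnot ⟨hp, hq⟩
        simp only [J, Finset.mem_filter] at hp
        obtain ⟨-, l, hl, hne⟩ := hp
        have := hz l hl
        rw [hJ _ hqn l hl, add_zero] at this
        exact hne this
      · have hpn : p y ∉ J := fun hp => hnot ⟨hp, hq⟩
        simp only [J, Finset.mem_filter] at hq
        obtain ⟨-, l, hl, hne⟩ := hq
        have := hz l hl
        rw [hJ _ hpn l hl, zero_add] at this
        exact hne this
  have hcount := sum_card_incidenceGroup (p := p) (q := q) J
  rw [Finset.sum_const_nat fun i _ => h.card_group i] at hcount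
  have hcov := (Finset.card_le_card hcover).trans (Finset.card_union_le _ _)
  rw [hT] at hcov
  change _ = _ + E.card at hcount
  have hmain : J.card * (r + 1) ≤ K * r + (E \ T).card + E.card := by omega
  -- membership in `E \ T` gives a linear relation
  have hrel : ∀ y ∈ E \ T, p y ∈ J ∧ q y ∈ J ∧ p y ≠ q y ∧ ∀ l ∈ L, l (p y) + l (q y) = 0 := by
    intro y hy
    obtain ⟨hyE, hyT⟩ := Finset.mem_sdiff.mp hy
    obtain ⟨h1, h2, h3⟩ := mem_edgesWithin.mp hyE
    have h4 : p y ≠ q y := (Finset.mem_filter.mp h1).2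
    exact ⟨h2, h3, h4, fun l hl => hshared l hl y hyT h4⟩
  have hone : (E \ T).Nonempty → Module.finrank F L < J.card := by
    rintro ⟨y, hy⟩
    obtain ⟨hp, hq, hne, hz⟩ := hrel y hy
    refine lt_of_le_of_lt (finrank_le_card_of_forall_eq_zero L (J.erase (p y)) ?_)
      (Finset.card_erase_lt_of_mem hp)
    intro l hl hl0
    funext i
    by_cases hiJ : i ∈ J
    · by_cases hip : i = p y
      · have := hz l hl
        rw [hl0 (q y) (Finset.mem_erase.mpr ⟨hne.symm, hq⟩), add_zero] at this
        rw [hip, this, Pi.zero_apply]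
      · exact hl0 i (Finset.mem_erase.mpr ⟨hip, hiJ⟩)
    · exact hJ i hiJ l hl
  have htwo : 1 < (E \ T).card → Module.finrank F L + 2 ≤ J.card := by
    intro hlt
    obtain ⟨y, hy, z, hz, hyz⟩ := Finset.one_lt_card.mp hlt
    obtain ⟨hpy, hqy, hny, hly⟩ := hrel y hy
    obtain ⟨hpz, hqz, hnz, hlz⟩ := hrel z hz
    -- two ends `a`, `b` of `y` with `a` not an end of `z`
    obtain ⟨a, b, ha, hb, hab, hlab, hap, haq⟩ : ∃ a b, a ∈ J ∧ b ∈ J ∧ a ≠ b ∧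
        (∀ l ∈ L, l b = 0 → l a = 0) ∧ a ≠ p z ∧ a ≠ q z := by
      by_cases hc : p y ≠ p z ∧ p y ≠ q z
      · refine ⟨p y, q y, hpy, hqy, hny, fun l hl h0 => ?_, hc.1, hc.2⟩
        simpa [h0] using hly l hl
      · refine ⟨q y, p y, hqy, hpy, hny.symm, fun l hl h0 => ?_, ?_, ?_⟩
        · simpa [h0] using hly l hl
        · intro h1
          have h2 : p y = q z := by
            by_contra h2
            exact hc ⟨fun h3 => hny (h3.trans h1.symm), h2⟩
          exact hyz (h.inj y z hny (Sym2.eq_iff.mpr (Or.inr ⟨h2, h1⟩)))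
        · intro h1
          have h2 : p y = p z := by
            by_contra h2
            exact hc ⟨h2, fun h3 => hny (h3.trans h1.symm)⟩
          exact hyz (h.inj y z hny (Sym2.eq_iff.mpr (Or.inl ⟨h2, h1⟩)))
    have hmem : a ∈ J.erase (p z) := Finset.mem_erase.mpr ⟨hap, ha⟩
    have hc1 := Finset.card_erase_add_one hmem
    have hc2 := Finset.card_erase_add_one hpz
    suffices Module.finrank F L ≤ ((J.erase (p z)).erase a).card by omega
    refine finrank_le_card_of_forall_eq_zero L _ fun l hl hl0 => ?_
    have hlpz : l (p z) = 0 := by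
      have := hlz l hl
      rwa [hl0 (q z) (by simp [haq.symm, hnz.symm, hqz]), add_zero] at this
    have hlb : l b = 0 := by
      by_cases hbz : b = p z
      · rw [hbz, hlpz]
      · exact hl0 b (by simp [hab.symm, hbz, hb])
    funext i
    by_cases hiJ : i ∈ J
    · by_cases hia : i = a
      · rw [hia, hlab l hl hlb, Pi.zero_apply]
      · by_cases hiz : i = p z
        · rw [hiz, hlpz, Pi.zero_apply]
        · exact hl0 i (by simp [hia, hiz, hiJ])
    · exact hJ i hiJ l hl
  -- `J.card = K` leaves no edge outside `T`, so `J` spans `K` edges, against sparsity. `J.card = K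
  -- + 1` leaves at most one, and `J.card ≥ K + 2` at most `r`; both contradict `hmain` since at
  -- most `r` coordinates are shared.
  rcases Nat.lt_or_ge J.card (K + 2) with hlt | hge
  · rcases Nat.lt_or_ge J.card (K + 1) with hlt' | hge'
    · have hJK : J.card = K := by omega
      have hempty : (E \ T).card = 0 := by
        by_contra hne
        have := hone (Finset.card_pos.mp (by omega))
        omega
      have hs : E.card < K := h.sparse J hJK
      rw [hJK, hempty, mul_add] at hmain
      omega
    · have hJK : J.card = K + 1 := by omega
      have hle : (E \ T).card ≤ 1 := by
        by_contra hne
        have := htwo (by omega)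
        omega
      rw [hJK] at hmain
      nlinarith
  · have := Nat.mul_le_mul_right (r + 1) hge
    nlinarith

end Incidence

/-! ### The code of an arrangement -/

section GroupCode

variable {ι : Type} [DecidableEq ι]

/-- The matrix whose rows are the indicator vectors of the groups. -/
def incidenceMatrix {β : Type*} (F : Type*) [Field F] (p q : β → ι) : Matrix ι β F :=
  fun i y => if p y = i ∨ q y = i then 1 else 0

theorem sum_incidenceMatrix_mul [Fintype ι] {β F : Type*} [Field F] (p q : β → ι) (l : ι → F) (y : β) :
    ∑ i, incidenceMatrix F p q i y * l i = if p y = q y then l (p y) else l (p y) + l (q y) := by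
  unfold incidenceMatrix
  split_ifs with h
  · simp [h]
  · have h1 : ∀ i, (if p y = i ∨ q y = i then (1 : F) else 0) * l i =
        (if p y = i then l i else 0) + (if q y = i then l i else 0) := by
      intro i
      by_cases hp : p y = i
      · have hq : q y ≠ i := fun hq => h (hp.trans hq.symm)
        simp [hp, hq]
      · simp [hp]
    simp [h1, Finset.sum_add_distrib]

theorem incidenceMatrix_mulVec {β F : Type*} [Fintype β] [DecidableEq β] [Field F] (p q : β → ι)
    (c : β → F) (i : ι) :
    (incidenceMatrix F p q).mulVec c i = ∑ y ∈ incidenceGroup p q i, c y := by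
  simp [Matrix.mulVec, dotProduct, incidenceMatrix, incidenceGroup, Finset.sum_filter]

/-- The codewords of the parity check code vanishing on `T`. -/
def vanishingSubspace {β F : Type*} [Field F] (V : Submodule F (β → F)) (T : Finset β) :
    Submodule F V :=
  LinearMap.ker ((LinearMap.funLeft F F ((↑) : T → β)).comp V.subtype)

theorem mem_vanishingSubspace {β F : Type*} [Field F] {V : Submodule F (β → F)} {T : Finset β}
    {c : V} : c ∈ vanishingSubspace V T ↔ ∀ y ∈ T, (c : β → F) y = 0 := by
  simp [vanishingSubspace, funext_iff, LinearMap.funLeft]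

/-- Rank–nullity for `M`, `B` and the transpose of `B`: imposing zeros on `T` lowers the dimension
by at least `K * r` minus the number of independent row relations outside `T`. That number is below
`K`, and `K * r - K + 1 = k`. -/
theorem IsSparseIncidence.finrank_vanishingSubspace_add_le [Fintype ι] {β F : Type*}
    [Fintype β] [DecidableEq β] [Field F] {r K k : ℕ} {p q : β → ι} (h : IsSparseIncidence r K p q)
    (hK : 1 ≤ K) (hk : k + K = K * r + 1) {T : Finset β} (hT : T.card = K * r) :
    Module.finrank F (vanishingSubspace (LinearMap.ker (incidenceMatrix F p q).mulVecLin) T) + k ≤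
      Module.finrank F (LinearMap.ker (incidenceMatrix F p q).mulVecLin) := by
  set M := incidenceMatrix F p q with hM
  let B : Matrix ι {y // y ∉ T} F := M.submatrix id (fun y => y.1)
  have hV := LinearMap.finrank_range_add_finrank_ker M.mulVecLin
  have hVr : Module.finrank F (LinearMap.range M.mulVecLin) ≤ Fintype.card ι := by
    simpa using Submodule.finrank_le (LinearMap.range M.mulVecLin)
  have hB := LinearMap.finrank_range_add_finrank_ker B.mulVecLin
  have hBt := LinearMap.finrank_range_add_finrank_ker B.transpose.mulVecLin
  have hrank : Module.finrank F (LinearMap.range B.transpose.mulVecLin)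
      = Module.finrank F (LinearMap.range B.mulVecLin) := B.rank_transpose
  have hker : Module.finrank F (LinearMap.ker B.transpose.mulVecLin) < K := by
    have hrel : ∀ l ∈ LinearMap.ker B.transpose.mulVecLin, ∀ y ∉ T,
        (if p y = q y then l (p y) else l (p y) + l (q y)) = 0 := by
      intro l hl y hy
      rw [← sum_incidenceMatrix_mul]
      exact congrFun (LinearMap.mem_ker.mp hl) ⟨y, hy⟩
    refine h.finrank_lt hK hT _ (fun l hl y hy hpq => ?_) (fun l hl y hy hpq => ?_)
    · simpa [hpq] using hrel l hl y hy
    · simpa [hpq] using hrel l hl y hy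
  let φ : vanishingSubspace (LinearMap.ker M.mulVecLin) T →ₗ[F] ({y // y ∉ T} → F) :=
    ((LinearMap.funLeft F F (fun y : {y // y ∉ T} => y.1)).comp
      (LinearMap.ker M.mulVecLin).subtype).comp (Submodule.subtype _)
  have hφ : Function.Injective φ := by
    intro c c' hcc'
    ext y
    by_cases hy : y ∈ T
    · exact (mem_vanishingSubspace.mp c.2 y hy).trans (mem_vanishingSubspace.mp c'.2 y hy).symm
    · exact congrFun hcc' ⟨y, hy⟩
  have hrange : LinearMap.range φ ≤ LinearMap.ker B.mulVecLin := by
    rintro _ ⟨c, rfl⟩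
    rw [LinearMap.mem_ker]
    funext i
    have h1 : M.mulVec (c : LinearMap.ker M.mulVecLin) i = 0 :=
      congrFun (LinearMap.mem_ker.mp (c : LinearMap.ker M.mulVecLin).2) i
    rw [Pi.zero_apply, ← h1]
    change ∑ y : {y // y ∉ T}, M i y * (c : LinearMap.ker M.mulVecLin).1 y = ∑ y, _
    rw [← Fintype.sum_subtype_add_sum_subtype (fun y => y ∉ T)]
    rw [left_eq_add]
    refine Finset.sum_eq_zero fun y _ => ?_
    rw [mem_vanishingSubspace.mp c.2 y.1 (by simpa using y.2), mul_zero]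
  have hW := (LinearMap.finrank_range_of_inj hφ).symm.trans_le (Submodule.finrank_mono hrange)
  have hcT : Fintype.card {y // y ∉ T} + T.card = Fintype.card β := by
    rw [Fintype.card_subtype_compl, Fintype.card_coe]
    exact Nat.sub_add_cancel (Finset.card_le_univ T)
  rw [Module.finrank_fintype_fun_eq_card] at hV hB hBt
  omega

theorem IsSparseIncidence.exists_isLRC [Fintype ι] {n r K k : ℕ} {p q : Fin n → ι}
    (h : IsSparseIncidence r K p q) (hK : 1 ≤ K) (hk : k + K = K * r + 1) (hn : K * r ≤ n) :
    ∃ (F : Type) (_ : Field F) (_ : Finite F) (_ : DecidableEq F) (C : Submodule F (Fin n → F)),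
      IsLRC k r C ∧ ∀ c ∈ C, c ≠ 0 → n < hammingNorm c + K * r := by
  -- The field must have more elements than there are sets `T`, of which there are at most `2 ^ n`.
  obtain ⟨ℓ, hℓ, hprime⟩ := Nat.exists_infinite_primes (2 ^ n + 1)
  have : Fact ℓ.Prime := ⟨hprime⟩
  let F := ZMod ℓ
  let V : Submodule F (Fin n → F) := LinearMap.ker (incidenceMatrix F p q).mulVecLin
  let κ := {T : Finset (Fin n) // T.card = K * r}
  obtain ⟨T0, hT0⟩ := Finset.exists_subset_card_eq
    (s := (Finset.univ : Finset (Fin n))) (n := K * r) (by simpa using hn)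
  have : Nonempty κ := ⟨⟨T0, hT0.2⟩⟩
  have hκ : Nat.card κ < Nat.card F := by
    have h1 : Nat.card κ ≤ Nat.card (Finset (Fin n)) := Finite.card_subtype_le _
    have h2 : Nat.card (Finset (Fin n)) = 2 ^ n := by simp
    have h3 : Nat.card F = ℓ := Nat.card_zmod ℓ
    omega
  obtain ⟨C, hC, hdisj⟩ := exists_submodule_disjoint
    (fun T : κ => vanishingSubspace V T.1) hκ k
    (fun T => h.finrank_vanishingSubspace_add_le hK hk T.2)
  refine ⟨F, inferInstance, inferInstance, inferInstance, C.map V.subtype, ⟨?_, fun y => ?_⟩, ?_⟩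
  · rw [Submodule.finrank_map_subtype_eq, hC]
  · have hy : y ∈ incidenceGroup p q (p y) := by simp [incidenceGroup]
    refine ⟨(incidenceGroup p q (p y)).erase y, fun _ => -1, by simp, ?_, ?_⟩
    · rw [Finset.card_erase_of_mem hy, h.card_group]
      rfl
    · rintro _ ⟨c, -, rfl⟩
      have h1 : (incidenceMatrix F p q).mulVec c (p y) = 0 :=
        congrFun (LinearMap.mem_ker.mp c.2) (p y)
      rw [incidenceMatrix_mulVec, ← Finset.add_sum_erase _ _ hy] at h1
      rw [← Finset.mul_sum, neg_one_mul]
      exact eq_neg_of_add_eq_zero_left h1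
  · rintro _ ⟨c, hc, rfl⟩ hne
    by_contra! hle
    let Z : Finset (Fin n) := Finset.univ.filter fun y => (c : Fin n → F) y = 0
    have hZ : Z.card + hammingNorm (c : Fin n → F) = n := by
      have := Finset.card_filter_add_card_filter_not (s := (Finset.univ : Finset (Fin n)))
        (fun y => (c : Fin n → F) y = 0)
      simpa [Z, hammingNorm] using this
    change hammingNorm (c : Fin n → F) + K * r ≤ n at hle
    obtain ⟨T, hTZ, hT⟩ := Finset.exists_subset_card_eq (s := Z) (n := K * r) (by omega)
    have hcW : c ∈ vanishingSubspace V T := mem_vanishingSubspace.mpr fun y hy =>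
      (Finset.mem_filter.mp (hTZ hy)).2
    have h0 := Submodule.disjoint_def.mp (hdisj ⟨T, hT⟩) c hc hcW
    exact hne (by rw [h0]; rfl)

end GroupCode

/-! ### Arrangements from graphs -/

section Arrangement

variable {ι : Type} [DecidableEq ι]

theorem IsSparseIncidence.comp_equiv {β γ : Type} [Fintype β] [Fintype γ] [DecidableEq β]
    [DecidableEq γ] {r K : ℕ} {p q : β → ι} (h : IsSparseIncidence r K p q) (e : γ ≃ β) :
    IsSparseIncidence r K (p ∘ e) (q ∘ e) := by
  have hcard : ∀ P : β → Prop, ∀ [DecidablePred P],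
      (Finset.univ.filter fun y => P (e y)).card = (Finset.univ.filter P).card := by
    intro P _
    rw [Finset.card_filter, Finset.card_filter]
    exact Equiv.sum_comp e fun y => if P y then 1 else 0
  refine ⟨fun i => ?_, fun y z hy hyz => e.injective (h.inj _ _ hy hyz), fun A hA => ?_, ?_⟩
  · rw [← h.card_group i]
    exact hcard fun y => p y = i ∨ q y = i
  · refine lt_of_eq_of_lt ?_ (h.sparse A hA)
    simp only [edgesWithin, sharedCoords, Finset.filter_filter]
    exact hcard fun y => p y ≠ q y ∧ p y ∈ A ∧ q y ∈ A
  · refine le_of_eq_of_le ?_ h.card_shared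
    exact hcard fun y => p y ≠ q y

theorem exists_isSparseIncidence {α : Type} [Fintype α] [DecidableEq α] [Fintype ι] {n r K : ℕ}
    (a b : α → ι) (hne : ∀ e, a e ≠ b e) (hinj : ∀ e e', s(a e, b e) = s(a e', b e') → e = e')
    (hsparse : ∀ A : Finset ι, A.card = K →
      (Finset.univ.filter fun e => a e ∈ A ∧ b e ∈ A).card < K)
    (hr : Fintype.card α ≤ r) (hn : n + Fintype.card α = Fintype.card ι * (r + 1)) :
    ∃ p q : Fin n → ι, IsSparseIncidence r K p q := by
  let deg : ι → ℕ := fun i => (incidenceGroup a b i).card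
  let β := α ⊕ Σ i, Fin (r + 1 - deg i)
  -- No vertex meets more than the at most `r` edges, so `r + 1 - deg i` private coordinates fill
  -- group `i` without truncation.
  have hdeg : ∀ i, deg i ≤ r + 1 := fun i => (Finset.card_le_univ _).trans (by omega)
  let p : β → ι := Sum.elim a Sigma.fst
  let q : β → ι := Sum.elim b Sigma.fst
  have hsum : ∑ i, deg i = Fintype.card α + Fintype.card α := by
    have h := sum_card_incidenceGroup (p := a) (q := b) Finset.univ
    simpa [edgesWithin, sharedCoords, hne] using h
  have hβ : Fintype.card β = n := by
    have h1 : ∑ i, (r + 1 - deg i) + ∑ i, deg i = Fintype.card ι * (r + 1) := by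
      rw [← Finset.sum_add_distrib,
        Finset.sum_congr rfl fun i _ => Nat.sub_add_cancel (hdeg i)]
      simp
    have h2 : Fintype.card β = Fintype.card α + ∑ i, (r + 1 - deg i) := by
      simp [β]
    omega
  have hshared : sharedCoords p q ⊆ Finset.univ.map Function.Embedding.inl := by
    rintro (e | ⟨i, j⟩) hy
    · exact Finset.mem_map_of_mem _ (Finset.mem_univ e)
    · simp [sharedCoords, p, q] at hy
  suffices h : IsSparseIncidence r K p q from
    ⟨_, _, h.comp_equiv (Fintype.equivFinOfCardEq hβ).symm⟩
  refine ⟨fun i => ?_, ?_, fun A hA => ?_, ?_⟩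
  · have h1 : (incidenceGroup p q i).card = deg i + (r + 1 - deg i) := by
      simp only [incidenceGroup, Finset.card_filter, deg]
      rw [Fintype.sum_sum_type, Fintype.sum_sigma]
      congr 1
      simp only [p, q, Sum.elim_inr, or_self]
      simp
      rfl
    have := hdeg i
    omega
  · rintro (e | ⟨i, j⟩) (e' | ⟨i', j'⟩) h1 h2
    · rw [hinj e e' h2]
    · have h3 : s(a e, b e) = s(i', i') := h2
      rcases Sym2.eq_iff.mp h3 with h | h <;> exact absurd (h.1.trans h.2.symm) (hne e)
    · exact absurd rfl h1
    · exact absurd rfl h1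
  · refine lt_of_le_of_lt ?_ (hsparse A hA)
    rw [← Finset.card_map (Function.Embedding.inl : α ↪ β)]
    refine Finset.card_le_card ?_
    intro y hy
    obtain ⟨h1, h2⟩ := mem_edgesWithin.mp hy
    obtain ⟨e, -, rfl⟩ := Finset.mem_map.mp (hshared h1)
    exact Finset.mem_map_of_mem _ (Finset.mem_filter.mpr ⟨Finset.mem_univ e, h2⟩)
  · refine (Finset.card_le_card hshared).trans ?_
    simpa using hr

/-- Any `K` vertices of `G` induce a graph without cycles, hence with fewer than `K` edges. -/
theorem GirthExceeds.exists_isSparseIncidence [Fintype ι] {G : SimpleGraph ι} {n m r K : ℕ}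
    (hG : GirthExceeds K G) (hK : 1 ≤ K) (hm : m ≤ G.edgeSet.ncard) (hmr : m ≤ r)
    (hn : n + m = Fintype.card ι * (r + 1)) :
    ∃ p q : Fin n → ι, IsSparseIncidence r K p q := by
  classical
  rw [← SimpleGraph.coe_edgeFinset, Set.ncard_coe_finset] at hm
  obtain ⟨E, hEG, rfl⟩ := Finset.exists_subset_card_eq hm
  have hrep : ∀ e : E, ∃ u : ι × ι, s(u.1, u.2) = (e : Sym2 ι) := fun ⟨e, _⟩ => by
    induction e with
    | _ a b => exact ⟨(a, b), rfl⟩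
  choose u hu using hrep
  have hadj : ∀ e : E, G.Adj (u e).1 (u e).2 := fun e => by
    rw [← SimpleGraph.mem_edgeSet, hu, ← SimpleGraph.mem_edgeFinset]
    exact hEG e.2
  refine _root_.exists_isSparseIncidence (fun e => (u e).1) (fun e => (u e).2)
    (fun e => (hadj e).ne) ?_ (fun A hA => ?_) (by simpa using hmr) (by simpa using hn)
  · intro e e' h
    rw [hu, hu] at h
    exact Subtype.ext h
  · rw [← hA]
    refine lt_of_le_of_lt ?_ (hG.ncard_edgeSet_induce_lt (Finset.card_pos.mp (by omega)) hA.le)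
    rw [← Set.ncard_image_of_injective (G.induce (A : Set ι)).edgeSet
      (Sym2.map.injective Subtype.val_injective), ← Set.ncard_coe_finset]
    refine Set.ncard_le_ncard_of_injOn (fun e : E => (e : Sym2 ι)) ?_
      Subtype.val_injective.injOn (Set.toFinite _)
    intro e he
    have he' := (Finset.mem_filter.mp he).2
    exact ⟨s(⟨_, he'.1⟩, ⟨_, he'.2⟩), hadj e, hu e⟩

end Arrangement

/-! ### The main equivalence -/

theorem mainTheorem4 (n k r : ℕ) (hr : 1 ≤ r) (hrk : r ≤ k) (hkn : k < n)
    (hn1 : lrcK1 k r ≤ lrcN1 n r)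
    (hk1 : 3 ≤ lrcK1 k r) (hk2 : lrcK2 k r = lrcK1 k r - 1) :
    LargestMinDistanceEq n k r (lrcDStar n k r) ↔
      lrcN2 n r ≤ exFamily (lrcN1 n r) (cycleFamily (lrcK1 k r)) := by
  constructor
  · rintro ⟨⟨d, ⟨F, _, _, C, hC, hd⟩, hdStar⟩, -⟩
    exact hC.lrcN2_le_exFamily hd hdStar hr (by omega) hn1 hk1 hk2
  · intro hle
    have hub : lrcDStar n k r ∈ upperBounds ((fun m : ℕ => (m : ℤ)) '' lrcMinDistances n k r) := by
      rintro _ ⟨d, ⟨F, _, _, C, hC, hd⟩, rfl⟩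
      exact hC.le_lrcDStar hd hr (by omega) (by omega) hn1
    refine ⟨?_, hub⟩
    have hK := le_lrcK1_mul hr k
    have hN := le_lrcN1_mul n r
    have hN' := lrcN1_mul_lt n r
    have hn2 : n + lrcN2 n r = lrcN1 n r * (r + 1) := by
      rw [lrcN2]
      omega
    have hk : k + lrcK1 k r = lrcK1 k r * r + 1 := by
      rw [lrcK2] at hk2
      omega
    obtain ⟨G, hG, hGcard⟩ := exists_extremal_graph (lrcN1 n r) (lrcK1 k r)
    obtain ⟨p, q, hpq⟩ := hG.exists_isSparseIncidence (n := n) (m := lrcN2 n r) (r := r)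
      (by omega) (by omega) (by omega) (by simpa using hn2)
    -- If `n₁ = k₁`, the extremal graph is a forest, so `n₂ < k₁`; otherwise `n > (n₁ - 1) * (r + 1)
    -- ≥ k₁ * (r + 1)`.
    have hn : lrcK1 k r * r ≤ n := by
      rcases hn1.eq_or_lt with heq | hlt
      · have h1 := exFamily_lt_of_le (n := lrcN1 n r) (k := lrcK1 k r) (by omega) heq.ge
        rw [← heq, mul_add] at hn2
        omega
      · have h1 := Nat.mul_le_mul_right (r + 1) (Nat.succ_le_iff.mpr hlt)
        rw [Nat.succ_mul, mul_add] at h1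
        omega
    obtain ⟨F, _, _, _, C, hC, hdist⟩ := hpq.exists_isLRC (by omega) hk hn
    have hne : ∃ c ∈ C, c ≠ 0 := by
      obtain ⟨c, hc, hne, -⟩ := exists_ne_zero_of_card_lt_finrank C ∅
        (by rw [hC.1, Finset.card_empty]; omega)
      exact ⟨c, hc, hne⟩
    classical
    obtain ⟨c, ⟨hc, hc0⟩, hmin⟩ := Set.exists_min_image {c | c ∈ C ∧ c ≠ 0}
      (fun c => hammingNorm c) (Set.toFinite _) hne
    have hd : HasMinDistance C (hammingNorm c) := by
      rw [hasMinDistance_iff]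
      refine ⟨⟨c, hc, hc0, by congr⟩, fun c' hc' hc0' => ?_⟩
      -- `congr` only reconciles different decidability instances in `hammingNorm`.
      exact le_of_eq_of_le (by congr) ((hmin c' ⟨hc', hc0'⟩).trans_eq (by congr))
    have hmem : ((hammingNorm c : ℕ) : ℤ) ∈ (fun m : ℕ => (m : ℤ)) '' lrcMinDistances n k r :=
      ⟨_, ⟨F, inferInstance, inferInstance, C, hC, hd⟩, rfl⟩
    have h1 := hub hmem
    have h2 := hdist c hc hc0
    have h3 : ((hammingNorm c : ℕ) : ℤ) = lrcDStar n k r := by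
      refine le_antisymm h1 ?_
      rw [lrcDStar]
      have : n < hammingNorm c + lrcK1 k r * r := by convert h2
      omega
    exact h3 ▸ hmem
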